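/- **Setting.** Fix $d,T\ge 1$, a context space $\mathcal X$ and a nonempty class $\mathcal F$ of functions $\mathcal X\to\mathbb R^d$. An oblivious adversary fixes a sequence $S=(x_1,\mathcal A_1),\dots,(x_T,\mathcal A_T)$ with $x_t\in\mathcal X$ and $\mathcal A_t\subseteq\{a\in\mathbb R^d:\|a\|\le 1\}$. In round $t$ the learner sees $(x_t,\mathcal A_t)$, plays $a_t\in\mathcal A_t$ and observes a random loss $\ell_t\in[-1,1]$ with conditional mean $\mu(a_t,x_t)$ given $a_t$ and the past; $\mu$ is unknown and takes values in $[-1,1]$. The regret is $$\mathrm{Reg}=\mathbb E\Big[\sum_{t=1}^T\mu(a_t,x_t)-\inf_{a\in\mathcal A_t}\mu(a,x_t)\Big],$$ and the average misspecification level is $$\varepsilon_T(S)=\inf_{f\in\mathcal F}\Big(\frac1T\sum_{t=1}^T\sup_{a\in\mathcal A_t}(\langle a,f(x_t)\rangle-\mu(a,x_t))^2\Big)^{1/2}.$$ **Oracle (Assumption 1).** A regression oracle receives $x_t$, outputs $\hat y_t\in\mathbb R^d$ depending on $x_1,\dots,x_t$ and $(a_s,\ell_s)_{s<t}$, and then observes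 $(a_t,\ell_t)$. It is assumed that for every sequence $(x_t,a_t,\ell_t)_{t=1}^T$ with $\|a_t\|\le1$ and $\ell_t\in[-1,1]$, $$\sum_{t=1}^T(\langle a_t,\hat y_t\rangle-\ell_t)^2-\inf_{f\in\mathcal F}\sum_{t=1}^T(\langle a_t,f(x_t)\rangle-\ell_t)^2\le \mathrm{Reg}_{\mathrm{Sq}}(T).$$ **Algorithm (SquareCB.Lin with learning rate $\gamma>0$).** In round $t$, let $\hat\theta_t$ be the oracle's prediction for $x_t$, draw $a_t$ (conditionally on the past) from any solution $p_t$ of the logdet-barrier problem $$\operatorname*{arg\,min}_{p\in\Delta(\mathcal A_t)}\ \langle\bar a_p,\hat\theta_t\rangle-\gamma^{-1}\log\det(H_p-\bar a_p\bar a_p^\top),\qquad \bar a_p=\mathbb E_{a\sim p}[a],\quad H_p=\mathbb E_{a\sim p}[aa^\top],$$ observe $\ell_t$, and update the oracle with $(x_t,a_t,\ell_t)$. Here $\Delta(\mathcal A_t)$ is the set of probability distributions with countable support in $\mathcal A_t$, $\det$ denotes the product of the $\dim(\mathcal A_t)$ largest eigenvalues, $\dim(\mathcal A_t)$ is the dimension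 of the affine hull of $\mathcal A_t$, and $-\log 0=+\infty$. **Theorem.** For every $c>0$ there is a constant $C$ depending only on $c$ such that the following holds in the above setting. Let $\varepsilon$ be such that $\mathrm{Reg}_{\mathrm{Sq}}(T)+\varepsilon^2T>0$, and let the learning rate be $$\gamma=c\,\sqrt{\frac{dT}{\mathrm{Reg}_{\mathrm{Sq}}(T)+\varepsilon^2T}}.$$ Then, for every sequence $S$ with $\varepsilon_T(S)\le\varepsilon$, SquareCB.Lin has $$\mathrm{Reg}\le C\Big(\sqrt{dT\,\mathrm{Reg}_{\mathrm{Sq}}(T)}+\varepsilon\sqrt d\,T\Big).$$ -/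

import Mathlib

open MeasureTheory ProbabilityTheory

noncomputable section

namespace LinearCB

/-- The ambient Euclidean space of actions and parameters. -/
abbrev Vec (d : ℕ) := EuclideanSpace ℝ (Fin d)

/-! ### The logdet-barrier distribution -/

/-- `Δ(A)`: probability distributions with countable support contained in `A`. -/
def distributionsOn {d : ℕ} (A : Set (Vec d)) : Set (PMF (Vec d)) :=
  {p | p.support ⊆ A}

/-- The mean action `E_{a ∼ p}[a]`. -/
def meanAction {d : ℕ} (p : PMF (Vec d)) : Vec d :=
  ∑' a : Vec d, (p a).toReal • a

/-- The second moment matrix `E_{a ∼ p}[a aᵀ]`. -/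
def secondMoment {d : ℕ} (p : PMF (Vec d)) : Matrix (Fin d) (Fin d) ℝ :=
  Matrix.of fun i j => ∑' a : Vec d, (p a).toReal * (a i * a j)

/-- The covariance matrix `H_p - ā_p ā_pᵀ`. -/
def actionCov {d : ℕ} (p : PMF (Vec d)) : Matrix (Fin d) (Fin d) ℝ :=
  secondMoment p - Matrix.of fun i j => meanAction p i * meanAction p j

theorem actionCov_isHermitian {d : ℕ} (p : PMF (Vec d)) : (actionCov p).IsHermitian := by
  ext i j
  simp [actionCov, secondMoment, mul_comm]

/-- The dimension of the smallest affine subspace containing `A`. -/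
def affineDim {d : ℕ} (A : Set (Vec d)) : ℕ :=
  Module.finrank ℝ (vectorSpan ℝ A)

/-- The product of the `k` largest eigenvalues of a symmetric matrix
(`eigenvalues₀` lists the eigenvalues in decreasing order, with multiplicity). -/
def topDet {d : ℕ} (k : ℕ) {M : Matrix (Fin d) (Fin d) ℝ} (hM : M.IsHermitian) : ℝ :=
  ∏ i ∈ Finset.univ.filter (fun i : Fin (Fintype.card (Fin d)) => (i : ℕ) < k), hM.eigenvalues₀ i

/-- `⟨ā_p, θ⟩ - γ⁻¹ log det (H_p - ā_p ā_pᵀ)`, where `det` is the product of the first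
`dim A` eigenvalues; it is `+∞` when that determinant vanishes. -/
def logdetObjective {d : ℕ} (θ : Vec d) (γ : ℝ) (A : Set (Vec d)) (p : PMF (Vec d)) : EReal :=
  if 0 < topDet (affineDim A) (actionCov_isHermitian p) then
    ((inner ℝ (meanAction p) θ
      - γ⁻¹ * Real.log (topDet (affineDim A) (actionCov_isHermitian p)) : ℝ) : EReal)
  else ⊤

/-- `logdet-barrier(θ, γ; A)`: the set of all minimizers over `Δ(A)`. -/
def logdetBarrier {d : ℕ} (θ : Vec d) (γ : ℝ) (A : Set (Vec d)) : Set (PMF (Vec d)) :=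
  {p | p ∈ distributionsOn A ∧
    ∀ q ∈ distributionsOn A, logdetObjective θ γ A p ≤ logdetObjective θ γ A q}

/-! ### Online regression oracles

Rounds are numbered `0, 1, …, T - 1`. -/

/-- A deterministic online regression oracle: in round `t` it maps the contexts
`x_0, …, x_t` and the past pairs `(a_s, ℓ_s)`, `s < t`, to a vector in `ℝ^d`. -/
structure RegressionOracle (X : Type*) (d : ℕ) where
  predict : (t : ℕ) → (Fin (t + 1) → X) → (Fin t → Vec d × ℝ) → Vec d
  measurable_predict : ∀ (t : ℕ) (c : Fin (t + 1) → X), Measurable (predict t c)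

/-- The oracle's prediction in round `t` along a sequence `(x_s, a_s, ℓ_s)_s`. -/
def RegressionOracle.prediction {X : Type*} {d : ℕ} (O : RegressionOracle X d)
    (x : ℕ → X) (a : ℕ → Vec d) (l : ℕ → ℝ) (t : ℕ) : Vec d :=
  O.predict t (fun s => x s) (fun s => (a s, l s))

/-- On every sequence of length `T` (actions in the unit ball, losses in `[-1, 1]`), the
square loss regret of the oracle against the class `F` is at most `R`. -/
def RegressionOracle.HasRegretBound {X : Type*} {d : ℕ} (O : RegressionOracle X d)
    (F : Set (X → Vec d)) (T : ℕ) (R : ℝ) : Prop :=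
  ∀ (x : ℕ → X) (a : ℕ → Vec d) (l : ℕ → ℝ),
    (∀ t < T, ‖a t‖ ≤ 1) → (∀ t < T, l t ∈ Set.Icc (-1 : ℝ) 1) →
    ∑ t ∈ Finset.range T, (inner ℝ (a t) (O.prediction x a l t) - l t) ^ 2
      - ⨅ f : F, ∑ t ∈ Finset.range T, (inner ℝ (a t) (f.1 (x t)) - l t) ^ 2 ≤ R

/-! ### Misspecification, the algorithm and its regret -/

/-- The average misspecification level of the sequence `(x_t, A_t)_{t < T}`. -/
def misspecification {X : Type*} {d : ℕ} (F : Set (X → Vec d)) (mu : Vec d → X → ℝ)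
    (T : ℕ) (x : ℕ → X) (A : ℕ → Set (Vec d)) : ℝ :=
  ⨅ f : F, Real.sqrt ((1 / (T : ℝ)) *
    ∑ t ∈ Finset.range T, ⨆ a : A t, (inner ℝ a.1 (f.1 (x t)) - mu a.1 (x t)) ^ 2)

/-- The random actions `a_t`, losses `l_t` and sampling distributions `p_t` arise from running
SquareCB.Lin with learning rate `γ` for `T` rounds on the fixed sequence `(x_t, A_t)`, when the
mean loss function is `mu`. The σ-algebra `ℱ t` describes what has happened before round `t`:
it contains the past actions and losses, and possibly further randomness, e.g. that used for
selecting one of several minimizers. -/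
structure IsSquareCBLinRun {X : Type*} {d : ℕ} {Ω : Type*} {mΩ : MeasurableSpace Ω}
    (P : Measure Ω) (ℱ : Filtration ℕ mΩ) (T : ℕ) (x : ℕ → X) (A : ℕ → Set (Vec d))
    (mu : Vec d → X → ℝ) (O : RegressionOracle X d) (γ : ℝ)
    (p : ℕ → Ω → PMF (Vec d)) (a : ℕ → Ω → Vec d) (l : ℕ → Ω → ℝ) : Prop where
  action_mem : ∀ t < T, ∀ ω, a t ω ∈ A t
  loss_mem : ∀ t < T, ∀ ω, l t ω ∈ Set.Icc (-1 : ℝ) 1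
  action_measurable : ∀ t < T, Measurable[ℱ (t + 1)] (a t)
  loss_measurable : ∀ t < T, Measurable[ℱ (t + 1)] (l t)
  /-- `p_t` is a logdet-barrier distribution for the oracle's current prediction. -/
  barrier : ∀ t < T, ∀ ω,
    p t ω ∈ logdetBarrier (O.prediction x (fun s => a s ω) (fun s => l s ω) t) γ (A t)
  /-- Given the past, `a_t` is drawn from `p_t`. -/
  action_law : ∀ t < T, ∀ B : Set (Vec d), MeasurableSet B →
    P[(a t ⁻¹' B).indicator (fun _ => (1 : ℝ)) | ℱ t]
      =ᵐ[P] fun ω => ((p t ω).toMeasure B).toReal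
  /-- Given the past and `a_t`, the loss `l_t` has mean `mu(a_t, x_t)`. -/
  loss_mean : ∀ t < T,
    P[l t | ℱ t ⊔ MeasurableSpace.comap (a t) inferInstance]
      =ᵐ[P] fun ω => mu (a t ω) (x t)

/-- The cumulative excess mean loss of an action sequence over the best unconstrained policy;
the pseudoregret is its expectation. -/
def excessLoss {X : Type*} {d : ℕ} (mu : Vec d → X → ℝ) (T : ℕ) (x : ℕ → X)
    (A : ℕ → Set (Vec d)) (a : ℕ → Vec d) : ℝ :=
  ∑ t ∈ Finset.range T, (mu (a t) (x t) - ⨅ b : A t, mu b.1 (x t))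

end LinearCB

end

/-!
Write `ā` and `Σ` for the mean and the covariance of the distribution `p` played in a round, `θ` for
the oracle's prediction and `f` for any member of the class.

*One round.* Mixing `p` with a point mass at `b ∈ A` is a rank one update of `Σ`, so by the matrix
determinant lemma the first-order optimality condition of the logdet barrier reads
`‖b - ā‖²_{Σ⁻¹} ≤ dim A + γ ⟨b - ā, θ⟩`. By Cauchy-Schwarz and AM-GM,
`⟨ā - b, f - θ⟩ ≤ γ⁻¹ ‖b - ā‖²_{Σ⁻¹} + (γ / 4) ‖f - θ‖²_Σ`. In the sum the leverages cancel, which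
leaves `⟨ā - b, f⟩ ≤ d / γ + (γ / 4) E_p ⟨a, f - θ⟩²` (`inner_meanAction_sub_le`). Since `A` need
not span the space, all this happens in coordinates on the direction of its affine hull (`IsFrame`),
where the product of the largest eigenvalues is a determinant (`IsFrame.topDet_actionCov`).

*All rounds.* The sum of the squared errors `⟨a_t, f(x_t) - θ_t⟩²` is, in expectation, at most twice
the oracle's regret bound plus a multiple of the squared misspecification of `f`
(`IsSquareCBLinRun.integral_sum_sq_predError_le`): the noise of the losses is orthogonal to the
prediction errors.
The transition between `E_p ⟨a, f - θ⟩²` and the squared errors at the actions played is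
`condExp_prod_ae_eq_integral_pmf`. Replacing the mean losses by `⟨a, f(x_t)⟩` costs the
misspecification once more. It remains to pass to the infimum over `f` and to insert the learning
rate (`regret_tuning`); here it matters that the regret bound of the oracle is nonnegative.
-/

namespace LinearCB

open Matrix

/-! ### Linear algebra -/

/-- If the columns of `B` are orthonormal, the product of the `k` largest eigenvalues of `B N Bᵀ` is
`det N`: the spectrum of `B N Bᵀ` is that of `N` together with `d - k` zeros, and these zeros come
last in the decreasing order because `N` is positive semidefinite. -/
theorem topDet_conj_eq_det {d k : ℕ} (hk : k ≤ d) {B : Matrix (Fin d) (Fin k) ℝ}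
    (hB : Bᵀ * B = 1) {N : Matrix (Fin k) (Fin k) ℝ} (hN : N.PosSemidef)
    {M : Matrix (Fin d) (Fin d) ℝ} (hM : M.IsHermitian) (hMN : M = B * N * Bᵀ) :
    topDet k hM = N.det := by
  have hchar : M.charpoly = Polynomial.X ^ (d - k) * N.charpoly := by
    rw [hMN, Matrix.charpoly_mul_comm_of_le (B * N) Bᵀ (by simpa using hk), ← Matrix.mul_assoc, hB,
      Matrix.one_mul]
    simp
  have hroots : M.charpoly.roots = N.charpoly.roots + Multiset.replicate (d - k) 0 := by
    rw [hchar, Polynomial.roots_mul, Polynomial.roots_X_pow, add_comm, Multiset.nsmul_singleton]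
    exact mul_ne_zero (pow_ne_zero _ Polynomial.X_ne_zero) N.charpoly_monic.ne_zero
  have hev : List.ofFn hM.eigenvalues₀
      = List.ofFn hN.1.eigenvalues₀ ++ List.replicate (d - k) (0 : ℝ) := by
    refine List.Perm.eq_of_sortedGE hM.eigenvalues₀_antitone.sortedGE_ofFn ?_ ?_
    · rw [List.sortedGE_iff_pairwise, List.pairwise_append]
      refine ⟨List.sortedGE_iff_pairwise.1 hN.1.eigenvalues₀_antitone.sortedGE_ofFn, ?_, ?_⟩
      · simp [List.pairwise_replicate]
      · intro a ha b hb
        rw [List.eq_of_mem_replicate hb]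
        obtain ⟨i, rfl⟩ := List.mem_ofFn.1 ha
        have := hN.eigenvalues_nonneg ((Fintype.equivOfCardEq (Fintype.card_fin _)) i)
        simpa [Matrix.IsHermitian.eigenvalues] using this
    · rw [← Multiset.coe_eq_coe, ← Multiset.coe_add, Multiset.coe_replicate]
      have h1 := hM.roots_charpoly_eq_eigenvalues₀
      have h2 := hN.1.roots_charpoly_eq_eigenvalues₀
      rw [Fin.univ_val_map] at h1 h2
      rw [h1, h2] at hroots
      exact hroots
  have hdet : N.det = (List.ofFn hN.1.eigenvalues₀).prod := by
    rw [hN.1.det_eq_prod_eigenvalues, List.prod_ofFn]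
    simp only [Matrix.IsHermitian.eigenvalues]
    exact Equiv.prod_comp (Fintype.equivOfCardEq (Fintype.card_fin _)).symm
      (fun i => hN.1.eigenvalues₀ i)
  have hlen : (List.ofFn hN.1.eigenvalues₀).length = k := by simp
  rw [hdet, ← List.take_left (l₁ := List.ofFn hN.1.eigenvalues₀)
    (l₂ := List.replicate (d - k) (0 : ℝ)), ← hev, hlen, List.prod_take_ofFn]
  rfl

/-- The matrix determinant lemma. -/
theorem det_add_smul_vecMulVec {k : ℕ} {N : Matrix (Fin k) (Fin k) ℝ} (hN : IsUnit N.det)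
    (η : ℝ) (u : Fin k → ℝ) :
    (N + η • vecMulVec u u).det = N.det * (1 + η * (u ⬝ᵥ N⁻¹ *ᵥ u)) := by
  have h : η • vecMulVec u u = replicateCol Unit (η • u) * replicateRow Unit u := by
    ext i j
    simp [vecMulVec_apply, Matrix.mul_apply, mul_assoc]
  rw [h, Matrix.det_add_replicateCol_mul_replicateRow hN]
  congr 1
  rw [Matrix.det_unique, Matrix.add_apply, Matrix.one_apply_eq, Matrix.mul_assoc]
  congr 1
  simp only [Matrix.mul_apply, replicateRow_apply, replicateCol_apply, dotProduct, mulVec,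
    Finset.mul_sum, Pi.smul_apply, smul_eq_mul]
  refine Finset.sum_congr rfl fun i _ => Finset.sum_congr rfl fun j _ => by ring

/-- The AM-GM form of the Cauchy-Schwarz inequality between the dual norms given by `N⁻¹` and `N`.
It is `0 ≤ (y + (γ / 2) w)ᵀ N (y + (γ / 2) w)` for `y = N⁻¹ u`. -/
theorem neg_dotProduct_le {k : ℕ} {N : Matrix (Fin k) (Fin k) ℝ} (hN : N.PosSemidef)
    (hu : IsUnit N.det) {γ : ℝ} (hγ : 0 < γ) (u w : Fin k → ℝ) :
    -(u ⬝ᵥ w) ≤ γ⁻¹ * (u ⬝ᵥ N⁻¹ *ᵥ u) + γ / 4 * (w ⬝ᵥ N *ᵥ w) := by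
  set y := N⁻¹ *ᵥ u with hy
  have hNy : N *ᵥ y = u := by
    rw [hy, mulVec_mulVec, Matrix.mul_nonsing_inv _ hu, one_mulVec]
  have h := hN.dotProduct_mulVec_nonneg (y + (γ / 2) • w)
  have hsymm : y ⬝ᵥ N *ᵥ w = u ⬝ᵥ w := by
    have hT : Nᵀ = N := by simpa using hN.1.eq
    rw [dotProduct_mulVec, ← mulVec_transpose, hT, hNy]
  simp only [star_trivial, mulVec_add, mulVec_smul, hNy, add_dotProduct, dotProduct_add,
    smul_dotProduct, dotProduct_smul, hsymm, smul_eq_mul, dotProduct_comm w u,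
    dotProduct_comm y u] at h
  have h2 := mul_nonneg (inv_nonneg.2 hγ.le) h
  have e : γ⁻¹ * (u ⬝ᵥ y + γ / 2 * (u ⬝ᵥ w) + γ / 2 * (u ⬝ᵥ w + γ / 2 * (w ⬝ᵥ N *ᵥ w)))
      = γ⁻¹ * (u ⬝ᵥ y) + u ⬝ᵥ w + γ / 4 * (w ⬝ᵥ N *ᵥ w) := by
    field_simp
    ring
  linarith

/-- An orthonormal basis of a subspace `V`, as the columns of a matrix `B`; then `B Bᵀ` is the
orthogonal projection onto `V`. -/
theorem exists_orthonormal_frame {d : ℕ} (V : Submodule ℝ (Vec d)) :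
    ∃ B : Matrix (Fin d) (Fin (Module.finrank ℝ V)) ℝ, Bᵀ * B = 1 ∧
      (∀ v ∈ V, B *ᵥ (Bᵀ *ᵥ v.ofLp) = v.ofLp) ∧ ∀ c, WithLp.toLp 2 (B *ᵥ c) ∈ V := by
  set b := stdOrthonormalBasis ℝ V
  have hcol : ∀ c : Fin (Module.finrank ℝ V) → ℝ,
      (Matrix.of fun i j => (b j : Vec d) i) *ᵥ c = (∑ j, c j • (b j : Vec d)).ofLp := by
    intro c
    ext i
    simp [mulVec, dotProduct, mul_comm]
  refine ⟨Matrix.of fun i j => (b j : Vec d) i, ?_, ?_, ?_⟩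
  · ext i j
    have h := orthonormal_iff_ite.1 b.orthonormal i j
    rw [Submodule.coe_inner, EuclideanSpace.inner_eq_star_dotProduct] at h
    rw [Matrix.one_apply, ← h]
    simp [Matrix.mul_apply, dotProduct, mul_comm]
  · intro v hv
    rw [hcol]
    congr 1
    have h := congrArg (Subtype.val) (b.sum_repr' ⟨v, hv⟩)
    rw [Submodule.coe_sum] at h
    simp only at h
    conv_rhs => rw [← h]
    refine Finset.sum_congr rfl fun j _ => ?_
    rw [Submodule.coe_smul, Submodule.coe_inner, EuclideanSpace.inner_eq_star_dotProduct]
    simp [mulVec, dotProduct, mul_comm]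
  · intro c
    rw [hcol, WithLp.toLp_ofLp]
    exact V.sum_mem fun j _ => V.smul_mem _ (b j).2

/-! ### Conditional expectations under a given conditional law -/

/-- The finite intersections of a countable generating family form a countable generating
π-system. -/
theorem exists_countable_piSystem (α : Type*) [m : MeasurableSpace α]
    [MeasurableSpace.CountablyGenerated α] :
    ∃ C : Set (Set α), C.Countable ∧ IsPiSystem C ∧ m = MeasurableSpace.generateFrom C := by
  classical
  have hc := MeasurableSpace.countable_countableGeneratingSet (α := α)
  have : Countable (MeasurableSpace.countableGeneratingSet α) := hc.to_subtype
  refine ⟨Set.range fun F : Finset (MeasurableSpace.countableGeneratingSet α) =>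
    ⋂ s ∈ F, (s : Set α), Set.countable_range _, ?_, le_antisymm ?_ ?_⟩
  · rintro _ ⟨F, rfl⟩ _ ⟨G, rfl⟩ -
    exact ⟨F ∪ G, by ext x; simp only [Set.mem_iInter, Set.mem_inter_iff, Finset.mem_union]; aesop⟩
  · conv_lhs => rw [← MeasurableSpace.generateFrom_countableGeneratingSet (α := α)]
    refine MeasurableSpace.generateFrom_mono fun s hs => ⟨{⟨s, hs⟩}, by simp⟩
  · refine MeasurableSpace.generateFrom_le ?_
    rintro _ ⟨F, rfl⟩
    exact F.measurableSet_biInter fun s _ =>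
      MeasurableSpace.measurableSet_countableGeneratingSet s.2

/-- If the conditional probability of `Y ∈ B` given `m` is `q(B)` for each measurable `B`, then
`E[f(V, Y) | m] = ∫ f(V, y) dq(y)` for every `m`-measurable `V`. The hypothesis has a null set for
each `B`, and `q` need not be measurable as a kernel; both are dealt with by comparing `q` with the
regular conditional distribution of `Y` given `m` on a countable π-system. -/
theorem condExp_prod_ae_eq_integral_pmf {Ω E : Type*} {m mΩ : MeasurableSpace Ω} (hm : m ≤ mΩ)
    {P : Measure Ω} [IsProbabilityMeasure P] [MeasurableSpace E] [StandardBorelSpace E]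
    {Y : Ω → E} (hY : Measurable Y) {q : Ω → PMF E}
    (hq : ∀ B : Set E, MeasurableSet B → P[(Y ⁻¹' B).indicator (fun _ => (1 : ℝ)) | m]
      =ᵐ[P] fun ω => ((q ω).toMeasure B).toReal)
    {S : Type*} [MeasurableSpace S] {V : Ω → S} (hV : Measurable[m] V)
    {f : S × E → ℝ} (hf : Measurable f) (hfi : Integrable (fun ω => f (V ω, Y ω)) P) :
    P[fun ω => f (V ω, Y ω) | m] =ᵐ[P] fun ω => ∫ y, f (V ω, y) ∂(q ω).toMeasure := by
  have hne : Nonempty E := ⟨Y (nonempty_of_isProbabilityMeasure P).some⟩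
  have hX : @Measurable Ω Ω mΩ m id := hm
  -- Conditioning on `m` is conditioning on the identity map from `(Ω, mΩ)` to `(Ω, m)`.
  set κ := @condDistrib Ω Ω E _ _ _ mΩ m Y id P _ with hκ
  have hcomap : (m.comap (id : Ω → Ω)) = m := MeasurableSpace.comap_id
  have hlaw : ∀ᵐ ω ∂P, κ ω = (q ω).toMeasure := by
    obtain ⟨C, hCc, hCpi, hCgen⟩ := exists_countable_piSystem E
    have hC : ∀ B ∈ C, ∀ᵐ ω ∂P, κ ω B = (q ω).toMeasure B := by
      intro B hB
      have hBm : MeasurableSet B := by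
        rw [hCgen]; exact MeasurableSpace.measurableSet_generateFrom hB
      have h1 := @condDistrib_ae_eq_condExp Ω Ω E _ _ _ mΩ P _ id Y m B hX hY hBm
      rw [hcomap] at h1
      filter_upwards [h1, hq B hBm] with ω h1 h2
      have h3 := h1.trans h2
      exact (ENNReal.toReal_eq_toReal_iff' (measure_ne_top _ _) (measure_ne_top _ _)).1 h3
    filter_upwards [(ae_ball_iff hCc).2 hC] with ω hω
    exact ext_of_generate_finite C hCgen hCpi hω (by simp)
  have h := @condExp_prod_ae_eq_integral_condDistrib Ω Ω E ℝ _ _ _ _ mΩ P _ id Y m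
    (fun z => f (V z.1, z.2)) _ _ hX hY.aemeasurable ?_ hfi
  · rw [hcomap] at h
    filter_upwards [h, hlaw] with ω h1 h2
    rw [← h2]
    exact h1
  · refine Measurable.stronglyMeasurable ?_
    exact hf.comp ((hV.comp measurable_fst).prodMk measurable_snd)

/-! ### Moments of action distributions -/

variable {d : ℕ} {A : Set (Vec d)} {p : PMF (Vec d)}

theorem ae_mem_of_mem_distributionsOn (hp : p ∈ distributionsOn A) : ∀ᵐ a ∂p.toMeasure, a ∈ A := by
  have h : ∀ᵐ a ∂p.toMeasure, a ∈ p.support := by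
    rw [ae_iff]
    have hm : MeasurableSet p.supportᶜ := p.support_countable.measurableSet.compl
    exact (p.toMeasure_apply_eq_zero_iff hm).2 disjoint_compl_right
  exact h.mono fun a ha => hp ha

theorem integrable_toMeasure_of_continuous {E : Type*} [NormedAddCommGroup E]
    [SecondCountableTopology E]
    (hA : ∀ b ∈ A, ‖b‖ ≤ 1) (hp : p ∈ distributionsOn A) {g : Vec d → E} (hg : Continuous g) :
    Integrable g p.toMeasure := by
  obtain ⟨C, hC⟩ :=
    (isCompact_closedBall (0 : Vec d) 1).exists_bound_of_continuousOn hg.continuousOn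
  refine Integrable.of_bound hg.aestronglyMeasurable C ?_
  filter_upwards [ae_mem_of_mem_distributionsOn hp] with a ha
  exact hC a (by simpa using hA a ha)

theorem meanAction_eq_integral (hA : ∀ b ∈ A, ‖b‖ ≤ 1) (hp : p ∈ distributionsOn A) :
    meanAction p = ∫ a, a ∂p.toMeasure :=
  (p.integral_eq_tsum _ (integrable_toMeasure_of_continuous hA hp continuous_id)).symm

theorem secondMoment_apply_eq_integral (hA : ∀ b ∈ A, ‖b‖ ≤ 1) (hp : p ∈ distributionsOn A)
    (i j : Fin d) : secondMoment p i j = ∫ a : Vec d, a i * a j ∂p.toMeasure :=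
  (p.integral_eq_tsum _ (integrable_toMeasure_of_continuous hA hp
    (g := fun a : Vec d => a i * a j) (by fun_prop))).symm

theorem integral_dotProduct (hA : ∀ b ∈ A, ‖b‖ ≤ 1) (hp : p ∈ distributionsOn A) (w : Fin d → ℝ) :
    ∫ a : Vec d, a.ofLp ⬝ᵥ w ∂p.toMeasure = (meanAction p).ofLp ⬝ᵥ w := by
  have h := integral_inner (𝕜 := ℝ)
    (integrable_toMeasure_of_continuous hA hp (g := fun a : Vec d => a) continuous_id)
    (WithLp.toLp 2 w)
  simp only [EuclideanSpace.inner_eq_star_dotProduct, star_trivial] at h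
  rw [h, meanAction_eq_integral hA hp]

theorem meanAction_apply_eq_integral (hA : ∀ b ∈ A, ‖b‖ ≤ 1) (hp : p ∈ distributionsOn A)
    (i : Fin d) : meanAction p i = ∫ a : Vec d, a i ∂p.toMeasure := by
  have h := integral_dotProduct hA hp (Pi.single i 1)
  simpa using h.symm

theorem actionCov_quadratic (hA : ∀ b ∈ A, ‖b‖ ≤ 1) (hp : p ∈ distributionsOn A)
    (w : Fin d → ℝ) : w ⬝ᵥ actionCov p *ᵥ w
      = ∫ a : Vec d, (a.ofLp ⬝ᵥ w) ^ 2 ∂p.toMeasure - ((meanAction p).ofLp ⬝ᵥ w) ^ 2 := by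
  have h : ∫ a : Vec d, (a.ofLp ⬝ᵥ w) ^ 2 ∂p.toMeasure
      = ∑ i, ∑ j, w i * (secondMoment p i j * w j) := by
    have e : ∀ a : Vec d, (a.ofLp ⬝ᵥ w) ^ 2 = ∑ i, ∑ j, w i * ((a i * a j) * w j) := by
      intro a
      rw [sq, dotProduct, Finset.sum_mul_sum]
      exact Finset.sum_congr rfl fun i _ => Finset.sum_congr rfl fun j _ => by ring
    simp_rw [e]
    rw [integral_finsetSum _ fun i _ => integrable_finsetSum _ fun j _ =>
      integrable_toMeasure_of_continuous hA hp (by fun_prop)]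
    refine Finset.sum_congr rfl fun i _ => ?_
    rw [integral_finsetSum _ fun j _ => integrable_toMeasure_of_continuous hA hp (by fun_prop)]
    refine Finset.sum_congr rfl fun j _ => ?_
    rw [integral_const_mul, integral_mul_const, secondMoment_apply_eq_integral hA hp]
  rw [h, actionCov, sub_mulVec, dotProduct_sub]
  congr 1
  · simp [dotProduct, mulVec, Finset.mul_sum]
  · rw [sq, dotProduct, dotProduct, Finset.sum_mul_sum]
    simp only [dotProduct, mulVec, Matrix.of_apply, Finset.mul_sum]
    exact Finset.sum_congr rfl fun i _ => Finset.sum_congr rfl fun j _ => by ring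

theorem actionCov_quadratic_eq_variance (hA : ∀ b ∈ A, ‖b‖ ≤ 1) (hp : p ∈ distributionsOn A)
    (w : Fin d → ℝ) : w ⬝ᵥ actionCov p *ᵥ w
      = ∫ a : Vec d, (a.ofLp ⬝ᵥ w - (meanAction p).ofLp ⬝ᵥ w) ^ 2 ∂p.toMeasure := by
  rw [actionCov_quadratic hA hp]
  set m := (meanAction p).ofLp ⬝ᵥ w
  have e : ∀ a : Vec d, (a.ofLp ⬝ᵥ w - m) ^ 2
      = (a.ofLp ⬝ᵥ w) ^ 2 - ((2 * m) * (a.ofLp ⬝ᵥ w) - m ^ 2) := fun a => by ring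
  have hc : Continuous fun a : Vec d => a.ofLp ⬝ᵥ w := by
    simp only [dotProduct]; fun_prop
  simp_rw [e]
  rw [integral_sub, integral_sub, integral_const_mul, integral_dotProduct hA hp]
  · simp only [integral_const, probReal_univ, smul_eq_mul]
    ring
  all_goals exact integrable_toMeasure_of_continuous hA hp (by fun_prop)

theorem actionCov_quadratic_le (hA : ∀ b ∈ A, ‖b‖ ≤ 1) (hp : p ∈ distributionsOn A)
    (w : Fin d → ℝ) : w ⬝ᵥ actionCov p *ᵥ w ≤ ∫ a : Vec d, (a.ofLp ⬝ᵥ w) ^ 2 ∂p.toMeasure := by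
  rw [actionCov_quadratic hA hp]
  linarith [sq_nonneg ((meanAction p).ofLp ⬝ᵥ w)]

theorem actionCov_posSemidef (hA : ∀ b ∈ A, ‖b‖ ≤ 1) (hp : p ∈ distributionsOn A) :
    (actionCov p).PosSemidef := by
  refine .of_dotProduct_mulVec_nonneg (actionCov_isHermitian p) fun w => ?_
  rw [star_trivial, actionCov_quadratic_eq_variance hA hp]
  exact integral_nonneg fun a => sq_nonneg _

theorem meanAction_dotProduct_of_const (hA : ∀ b ∈ A, ‖b‖ ≤ 1) (hp : p ∈ distributionsOn A)
    {w : Fin d → ℝ} {r : ℝ} (hw : ∀ a ∈ A, a.ofLp ⬝ᵥ w = r) : (meanAction p).ofLp ⬝ᵥ w = r := by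
  rw [← integral_dotProduct hA hp, integral_congr_ae
    ((ae_mem_of_mem_distributionsOn hp).mono fun a ha => hw a ha)]
  simp

/-- A direction along which the actions do not vary is in the kernel of the covariance matrix. -/
theorem actionCov_mulVec_eq_zero_of_const (hA : ∀ b ∈ A, ‖b‖ ≤ 1) (hp : p ∈ distributionsOn A)
    {w : Fin d → ℝ} {r : ℝ} (hw : ∀ a ∈ A, a.ofLp ⬝ᵥ w = r) : actionCov p *ᵥ w = 0 := by
  rw [← (actionCov_posSemidef hA hp).dotProduct_mulVec_zero_iff, star_trivial,
    actionCov_quadratic_eq_variance hA hp, meanAction_dotProduct_of_const hA hp hw]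
  refine integral_eq_zero_of_ae ((ae_mem_of_mem_distributionsOn hp).mono fun a ha => ?_)
  simp [hw a ha]

/-- The columns of `B` form an orthonormal basis of the direction of the affine hull of `A`.
The last two fields say that `B Bᵀ` fixes this subspace and that `B` maps into it. -/
structure IsFrame {k : ℕ} (A : Set (Vec d)) (B : Matrix (Fin d) (Fin k) ℝ) : Prop where
  orthonormal : Bᵀ * B = 1
  mulVec_mulVec : ∀ v ∈ vectorSpan ℝ A, B *ᵥ (Bᵀ *ᵥ v.ofLp) = v.ofLp
  mem : ∀ c, WithLp.toLp 2 (B *ᵥ c) ∈ vectorSpan ℝ A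

namespace IsFrame
variable {k : ℕ} {B : Matrix (Fin d) (Fin k) ℝ}

theorem dotProduct_mulVec_transpose_mulVec {k : ℕ} (B : Matrix (Fin d) (Fin k) ℝ)
    (x w : Fin d → ℝ) : x ⬝ᵥ B *ᵥ Bᵀ *ᵥ w = (B *ᵥ Bᵀ *ᵥ x) ⬝ᵥ w := by
  rw [dotProduct_mulVec, dotProduct_mulVec, dotProduct_comm, dotProduct_comm _ w]
  congr 1
  rw [vecMul_transpose, ← mulVec_transpose B]

/-- The component of `w` orthogonal to the direction of `A` is constant on `A`. -/
theorem dotProduct_sub_proj (hB : IsFrame A B) (w : Fin d → ℝ) {a b : Vec d} (ha : a ∈ A)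
    (hb : b ∈ A) :
    a.ofLp ⬝ᵥ (w - B *ᵥ (Bᵀ *ᵥ w)) = b.ofLp ⬝ᵥ (w - B *ᵥ (Bᵀ *ᵥ w)) := by
  have h := hB.mulVec_mulVec _ (vsub_mem_vectorSpan ℝ ha hb)
  rw [← sub_eq_zero, ← sub_dotProduct]
  rw [vsub_eq_sub, WithLp.ofLp_sub] at h
  rw [dotProduct_sub, dotProduct_mulVec_transpose_mulVec, h, sub_self]

theorem proj_sub_meanAction (hB : IsFrame A B) (hA : ∀ b ∈ A, ‖b‖ ≤ 1)
    (hp : p ∈ distributionsOn A) {b : Vec d} (hb : b ∈ A) :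
    B *ᵥ (Bᵀ *ᵥ (b - meanAction p).ofLp) = (b - meanAction p).ofLp := by
  symm
  rw [← sub_eq_zero, ← dotProduct_eq_zero_iff]
  intro w
  have h := meanAction_dotProduct_of_const hA hp
    (fun a ha => hB.dotProduct_sub_proj w ha hb)
  rw [sub_dotProduct, ← dotProduct_mulVec_transpose_mulVec, ← dotProduct_sub,
    WithLp.ofLp_sub, sub_dotProduct, h, sub_self]

/-- The range of the covariance matrix lies in the direction of `A`, so that compressing
it to coordinates on that subspace loses nothing. -/
theorem actionCov_eq (hB : IsFrame A B) (hA : ∀ b ∈ A, ‖b‖ ≤ 1) (hp : p ∈ distributionsOn A) :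
    actionCov p = B * (Bᵀ * actionCov p * B) * Bᵀ := by
  have hr : actionCov p = actionCov p * (B * Bᵀ) := by
    refine Matrix.ext_of_mulVec_single fun i => ?_
    obtain ⟨b, hb⟩ := p.support_nonempty
    have h := actionCov_mulVec_eq_zero_of_const hA hp
      (fun a ha => hB.dotProduct_sub_proj (Pi.single i 1) ha (hp hb))
    rw [mulVec_sub, sub_eq_zero] at h
    rw [h, Matrix.mulVec_mulVec, Matrix.mulVec_mulVec, Matrix.mul_assoc]
  have hs : (actionCov p)ᵀ = actionCov p := by simpa using (actionCov_isHermitian p).eq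
  have hl : actionCov p = B * Bᵀ * actionCov p := by
    have h := congrArg Matrix.transpose hr
    rw [transpose_mul, transpose_mul, transpose_transpose, hs] at h
    exact h
  calc actionCov p = B * Bᵀ * (actionCov p * (B * Bᵀ)) := by rw [← hr]; exact hl
    _ = _ := by simp only [Matrix.mul_assoc]

theorem posSemidef_compress (hA : ∀ b ∈ A, ‖b‖ ≤ 1) (hp : p ∈ distributionsOn A) :
    (Bᵀ * actionCov p * B).PosSemidef := by
  have h := (actionCov_posSemidef hA hp).conjTranspose_mul_mul_same B
  rwa [conjTranspose_eq_transpose_of_trivial] at h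

theorem le (hB : IsFrame A B) : k ≤ d := by
  have h := congrArg Matrix.rank hB.orthonormal
  rw [Matrix.rank_one, Fintype.card_fin] at h
  have := (Matrix.rank_mul_le_right Bᵀ B).trans (Matrix.rank_le_height B)
  omega

/-- In coordinates on the direction of `A` the pseudo-determinant is an honest determinant. -/
theorem topDet_actionCov (hB : IsFrame A B) (hA : ∀ b ∈ A, ‖b‖ ≤ 1)
    (hp : p ∈ distributionsOn A) :
    topDet k (actionCov_isHermitian p) = (Bᵀ * actionCov p * B).det :=
  topDet_conj_eq_det hB.le hB.orthonormal (posSemidef_compress hA hp) _ (hB.actionCov_eq hA hp)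

end IsFrame

theorem exists_isFrame (A : Set (Vec d)) :
    ∃ B : Matrix (Fin d) (Fin (affineDim A)) ℝ, IsFrame A B := by
  obtain ⟨B, h1, h2, h3⟩ := exists_orthonormal_frame (vectorSpan ℝ A)
  exact ⟨B, h1, h2, h3⟩

/-! ### The logdet barrier -/

/-- The mixture `(1 - η) p + η δ_b` for `0 ≤ η ≤ 1`. -/
noncomputable def mixPoint (p : PMF (Vec d)) (b : Vec d) (η : ℝ) (h0 : 0 ≤ η) (h1 : η ≤ 1) :
    PMF (Vec d) :=
  ⟨fun a => ENNReal.ofReal (1 - η) * p a + ENNReal.ofReal η * PMF.pure b a, by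
    rw [ENNReal.summable.hasSum_iff, ENNReal.tsum_add, ENNReal.tsum_mul_left, ENNReal.tsum_mul_left,
      PMF.tsum_coe, PMF.tsum_coe, mul_one, mul_one, ← ENNReal.ofReal_add (by linarith) h0,
      sub_add_cancel, ENNReal.ofReal_one]⟩

variable {b : Vec d} {η : ℝ} {h0 : 0 ≤ η} {h1 : η ≤ 1}

theorem toMeasure_mixPoint : (mixPoint p b η h0 h1).toMeasure
    = ENNReal.ofReal (1 - η) • p.toMeasure + ENNReal.ofReal η • Measure.dirac b := by
  rw [← PMF.toMeasure_pure]
  ext s hs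
  simp only [Measure.add_apply, Measure.smul_apply, smul_eq_mul, PMF.toMeasure_apply _ hs]
  rw [← ENNReal.tsum_mul_left, ← ENNReal.tsum_mul_left, ← ENNReal.tsum_add]
  refine tsum_congr fun a => ?_
  by_cases ha : a ∈ s
  · simp only [Set.indicator_of_mem ha]; rfl
  · simp [Set.indicator_of_notMem ha]

theorem mixPoint_mem (hp : p ∈ distributionsOn A) (hb : b ∈ A) :
    mixPoint p b η h0 h1 ∈ distributionsOn A := by
  intro a ha
  by_contra hna
  have h2 : p a = 0 := by
    rw [PMF.apply_eq_zero_iff]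
    exact fun h => hna (hp h)
  have h3 : PMF.pure b a = 0 := by
    rw [PMF.pure_apply, if_neg]
    rintro rfl
    exact hna hb
  refine (PMF.mem_support_iff _ _).1 ha ?_
  change ENNReal.ofReal (1 - η) * p a + ENNReal.ofReal η * PMF.pure b a = 0
  rw [h2, h3]
  simp

theorem integral_mixPoint (hA : ∀ b ∈ A, ‖b‖ ≤ 1) (hp : p ∈ distributionsOn A)
    {g : Vec d → ℝ} (hg : Continuous g) :
    ∫ a, g a ∂(mixPoint p b η h0 h1).toMeasure = (1 - η) * ∫ a, g a ∂p.toMeasure + η * g b := by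
  rw [toMeasure_mixPoint, integral_add_measure, integral_smul_measure, integral_smul_measure,
    integral_dirac, ENNReal.toReal_ofReal (by linarith), ENNReal.toReal_ofReal h0, smul_eq_mul,
    smul_eq_mul]
  · exact (integrable_toMeasure_of_continuous hA hp hg).smul_measure ENNReal.ofReal_ne_top
  · exact (integrable_dirac (by simp)).smul_measure ENNReal.ofReal_ne_top

theorem meanAction_mixPoint (hA : ∀ b ∈ A, ‖b‖ ≤ 1) (hp : p ∈ distributionsOn A) (hb : b ∈ A) :
    meanAction (mixPoint p b η h0 h1) = meanAction p + η • (b - meanAction p) := by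
  ext i
  rw [meanAction_apply_eq_integral hA (mixPoint_mem hp hb),
    integral_mixPoint hA hp (g := fun a : Vec d => a i) (by fun_prop),
    ← meanAction_apply_eq_integral hA hp]
  simp only [PiLp.add_apply, PiLp.smul_apply, PiLp.sub_apply, smul_eq_mul]
  ring

/-- Mixing in a point mass at `b` is, up to a factor, a rank one update of the covariance. -/
theorem actionCov_mixPoint (hA : ∀ b ∈ A, ‖b‖ ≤ 1) (hp : p ∈ distributionsOn A) (hb : b ∈ A) :
    actionCov (mixPoint p b η h0 h1) = (1 - η) • (actionCov p
      + η • vecMulVec (b - meanAction p).ofLp (b - meanAction p).ofLp) := by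
  ext i j
  simp only [actionCov, Matrix.sub_apply, Matrix.smul_apply, Matrix.add_apply, Matrix.of_apply,
    vecMulVec_apply, meanAction_mixPoint hA hp hb,
    secondMoment_apply_eq_integral hA (mixPoint_mem hp hb),
    integral_mixPoint hA hp (g := fun a : Vec d => a i * a j) (by fun_prop),
    ← secondMoment_apply_eq_integral hA hp,
    PiLp.add_apply, PiLp.smul_apply, PiLp.sub_apply, smul_eq_mul]
  ring

/-- The objective is finite somewhere: an affinely independent subset of `A` with the same affine
hull is finite, and its uniform distribution has a covariance that is definite on the direction of
`A`. -/
theorem exists_topDet_pos (hA : ∀ b ∈ A, ‖b‖ ≤ 1) (hne : A.Nonempty) :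
    ∃ q ∈ distributionsOn A, 0 < topDet (affineDim A) (actionCov_isHermitian q) := by
  obtain ⟨B, hB⟩ := exists_isFrame A
  obtain ⟨t, htA, hspan, hind⟩ := exists_affineIndependent ℝ (Vec d) A
  have hfin : t.Finite := finite_set_of_fin_dim_affineIndependent ℝ hind
  lift t to Finset (Vec d) using hfin
  have htne : t.Nonempty := by
    rw [← Finset.coe_nonempty, ← affineSpan_nonempty ℝ, hspan, affineSpan_nonempty]
    exact hne
  set q := PMF.uniformOfFinset t htne with hq
  have hqA : q ∈ distributionsOn A := by
    intro a ha
    exact htA (by simpa [hq] using ha)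
  have hqt : q ∈ distributionsOn (t : Set (Vec d)) := by
    intro a ha
    simpa [hq] using ha
  refine ⟨q, hqA, ?_⟩
  rw [hB.topDet_actionCov hA hqA]
  refine Matrix.PosDef.det_pos (Matrix.PosDef.of_dotProduct_mulVec_pos
    (IsFrame.posSemidef_compress hA hqA).1 fun c hc => ?_)
  refine lt_of_le_of_ne ((IsFrame.posSemidef_compress hA hqA).dotProduct_mulVec_nonneg c) ?_
  intro h
  apply hc
  set w : Fin d → ℝ := B *ᵥ c with hw
  have hq0 : w ⬝ᵥ actionCov q *ᵥ w = 0 := by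
    rw [h, star_trivial, hw, ← Matrix.mulVec_mulVec, ← Matrix.mulVec_mulVec, dotProduct_mulVec c,
      vecMul_transpose]
  have h_cont : Continuous fun a : Vec d => (a.ofLp ⬝ᵥ w - (meanAction q).ofLp ⬝ᵥ w) ^ 2 := by
    simp only [dotProduct]; fun_prop
  rw [actionCov_quadratic_eq_variance hA hqA, integral_eq_zero_iff_of_nonneg
    (fun a => sq_nonneg _) (integrable_toMeasure_of_continuous hA hqA h_cont)] at hq0
  have hconst : ∀ a ∈ t, a.ofLp ⬝ᵥ w = (meanAction q).ofLp ⬝ᵥ w := by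
    intro a ha
    by_contra hne
    have h2 : q.toMeasure {a} = 0 :=
      measure_mono_null (fun x hx => by
        rw [Set.mem_singleton_iff.1 hx]
        simpa [sub_eq_zero] using hne) (ae_iff.1 hq0)
    rw [PMF.toMeasure_apply_singleton _ _ (measurableSet_singleton a),
      PMF.apply_eq_zero_iff] at h2
    exact h2 (by simpa [hq] using ha)
  have hvs : vectorSpan ℝ (t : Set (Vec d)) = vectorSpan ℝ A := by
    rw [← direction_affineSpan, hspan, direction_affineSpan]
  have horth : ∀ v ∈ vectorSpan ℝ A, v.ofLp ⬝ᵥ w = 0 := by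
    rw [← hvs]
    intro v hv
    induction hv using Submodule.span_induction with
    | mem x hx =>
      obtain ⟨a, ha, b, hb, rfl⟩ := hx
      simp [sub_dotProduct, hconst a ha, hconst b hb]
    | zero => simp
    | add x y _ _ hx hy => simp [add_dotProduct, hx, hy]
    | smul r x _ hx => simp [smul_dotProduct, hx]
  have hw0 : w = 0 := dotProduct_self_eq_zero.1 (horth _ (hB.mem c))
  have hBw : Bᵀ *ᵥ w = c := by
    rw [hw, Matrix.mulVec_mulVec, hB.orthonormal, one_mulVec]
  rw [← hBw, hw0, mulVec_zero]

theorem topDet_pos_of_mem_logdetBarrier (hA : ∀ b ∈ A, ‖b‖ ≤ 1) {θ : Vec d} {γ : ℝ}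
    (hp : p ∈ logdetBarrier θ γ A) : 0 < topDet (affineDim A) (actionCov_isHermitian p) := by
  obtain ⟨b, hb⟩ := p.support_nonempty
  obtain ⟨q, hq, hpos⟩ := exists_topDet_pos hA ⟨b, hp.1 hb⟩
  by_contra hn
  have h := hp.2 q hq
  rw [logdetObjective, logdetObjective, if_neg hn, if_pos hpos, top_le_iff] at h
  exact EReal.coe_ne_top _ h

/-- The first-order condition at `η = 0`, written for the increments of the objective. -/
theorem le_of_log_mixture_le {k D s γ : ℝ} (hk : 0 ≤ k) (hD : 0 ≤ D)
    (h : ∀ η, 0 < η → η < 1 →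
      k * Real.log (1 - η) + Real.log (1 + η * D) ≤ γ * (η * s)) :
    D ≤ k + γ * s := by
  have key : ∀ η, 0 < η → η < 1 → D / (1 + η * D) - k / (1 - η) ≤ γ * s := by
    intro η h0 h1
    have hp1 : 0 < 1 + η * D := by positivity
    have hp2 : 0 < 1 - η := by linarith
    have l1 := Real.one_sub_inv_le_log_of_pos hp1
    have l2 := mul_le_mul_of_nonneg_left (Real.one_sub_inv_le_log_of_pos hp2) hk
    have e1 : 1 - (1 + η * D)⁻¹ = η * (D / (1 + η * D)) := by field_simp; ring
    have e2 : k * (1 - (1 - η)⁻¹) = -(η * (k / (1 - η))) := by field_simp; ring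
    rw [e1] at l1
    rw [e2] at l2
    have := h η h0 h1
    refine le_of_mul_le_mul_left ?_ h0
    linarith
  have hc : ContinuousAt (fun η : ℝ => D / (1 + η * D) - k / (1 - η)) 0 := by
    refine ContinuousAt.sub (ContinuousAt.div ?_ ?_ ?_) (ContinuousAt.div ?_ ?_ ?_) <;>
      first | fun_prop | simp
  have ht := hc.tendsto.mono_left (nhdsWithin_le_nhds (s := Set.Ioi (0 : ℝ)))
  have := le_of_tendsto ht (by
    filter_upwards [Ioo_mem_nhdsGT (zero_lt_one' ℝ)] with η hη using key η hη.1 hη.2)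
  simp at this
  linarith

/-- The optimality condition of the logdet barrier. With `u = b - ā` in coordinates and `N` the
covariance, the leverage `uᵀ N⁻¹ u` of every action `b` is at most `dim A + γ ⟨b - ā, θ⟩`. It comes
from comparing `p` with the mixtures `(1 - η) p + η δ_b` as `η → 0`. -/
theorem leverage_le_of_mem_logdetBarrier (hA : ∀ b ∈ A, ‖b‖ ≤ 1) {θ : Vec d} {γ : ℝ} (hγ : 0 < γ)
    (hp : p ∈ logdetBarrier θ γ A) {B : Matrix (Fin d) (Fin (affineDim A)) ℝ} (hB : IsFrame A B)
    (hb : b ∈ A) :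
    Bᵀ *ᵥ (b - meanAction p).ofLp ⬝ᵥ (Bᵀ * actionCov p * B)⁻¹ *ᵥ (Bᵀ *ᵥ (b - meanAction p).ofLp)
      ≤ affineDim A + γ * inner ℝ (b - meanAction p) θ := by
  set N := Bᵀ * actionCov p * B with hN
  set u := Bᵀ *ᵥ (b - meanAction p).ofLp with hu
  have hpos := topDet_pos_of_mem_logdetBarrier hA hp
  have hdet := hB.topDet_actionCov hA hp.1
  rw [← hN] at hdet
  have hNpos : 0 < N.det := hdet ▸ hpos
  have hNu : IsUnit N.det := hNpos.ne'.isUnit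
  have hNinv : N⁻¹.PosSemidef := (IsFrame.posSemidef_compress hA hp.1).inv
  have hD : 0 ≤ u ⬝ᵥ N⁻¹ *ᵥ u := by simpa using hNinv.dotProduct_mulVec_nonneg u
  refine le_of_log_mixture_le (Nat.cast_nonneg _) hD fun η h0 h1 => ?_
  set q := mixPoint p b η h0.le h1.le with hq
  have hqA : q ∈ distributionsOn A := mixPoint_mem hp.1 hb
  have hcomp : Bᵀ * actionCov q * B = (1 - η) • (N + η • vecMulVec u u) := by
    rw [hq, actionCov_mixPoint hA hp.1 hb, Matrix.mul_smul, Matrix.smul_mul, Matrix.mul_add,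
      Matrix.add_mul, Matrix.mul_smul, Matrix.smul_mul, Matrix.mul_vecMulVec, Matrix.vecMulVec_mul,
      ← hu, ← mulVec_transpose, ← hu]
  have hqdet : topDet (affineDim A) (actionCov_isHermitian q)
      = (1 - η) ^ affineDim A * (N.det * (1 + η * (u ⬝ᵥ N⁻¹ *ᵥ u))) := by
    rw [hB.topDet_actionCov hA hqA, hcomp, det_smul, det_add_smul_vecMulVec hNu, Fintype.card_fin]
  have hp1 : 0 < (1 - η) ^ affineDim A := pow_pos (by linarith) _
  have hp2 : 0 < 1 + η * (u ⬝ᵥ N⁻¹ *ᵥ u) := by positivity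
  have hqpos : 0 < topDet (affineDim A) (actionCov_isHermitian q) := by
    rw [hqdet]; positivity
  have h := hp.2 q hqA
  rw [logdetObjective, logdetObjective, if_pos hpos, if_pos hqpos, EReal.coe_le_coe_iff, hqdet,
    hdet, hq, meanAction_mixPoint hA hp.1 hb, inner_add_left, real_inner_smul_left,
    Real.log_mul hp1.ne' (by positivity), Real.log_mul hNpos.ne' hp2.ne', Real.log_pow] at h
  have h2 : γ⁻¹ * (affineDim A * Real.log (1 - η) + Real.log (1 + η * (u ⬝ᵥ N⁻¹ *ᵥ u)))
      ≤ η * inner ℝ (b - meanAction p) θ := by linarith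
  rwa [inv_mul_le_iff₀ hγ] at h2

/-- The guarantee for one round: whatever the true parameter `f` is, the mean regret of a
logdet-barrier distribution against any action `b` is at most `d / γ` plus `γ / 4` times the mean
squared error of the parameter `θ` it was computed from. The leverage that bounds the estimation error
`⟨ā - b, f - θ⟩` cancels against the one that the optimality condition provides. -/
theorem inner_meanAction_sub_le (hA : ∀ b ∈ A, ‖b‖ ≤ 1) {θ : Vec d} {γ : ℝ} (hγ : 0 < γ)
    (hp : p ∈ logdetBarrier θ γ A) (hb : b ∈ A) (f : Vec d) :
    inner ℝ (meanAction p - b) f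
      ≤ d / γ + γ / 4 * ∫ a : Vec d, (inner ℝ a (f - θ)) ^ 2 ∂p.toMeasure := by
  obtain ⟨B, hB⟩ := exists_isFrame A
  set N := Bᵀ * actionCov p * B with hN
  set u := Bᵀ *ᵥ (b - meanAction p).ofLp with hu
  set v := (f - θ).ofLp with hv
  have hlev := leverage_le_of_mem_logdetBarrier hA hγ hp hB hb
  rw [← hN, ← hu] at hlev
  have hNu : IsUnit N.det := by
    have := topDet_pos_of_mem_logdetBarrier hA hp
    rw [hB.topDet_actionCov hA hp.1] at this
    exact this.ne'.isUnit
  have hcs := neg_dotProduct_le (IsFrame.posSemidef_compress hA hp.1) hNu hγ u (Bᵀ *ᵥ v)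
  rw [← hN] at hcs
  have hproj : B *ᵥ u = (b - meanAction p).ofLp := hB.proj_sub_meanAction hA hp.1 hb
  have huv : u ⬝ᵥ Bᵀ *ᵥ v = inner ℝ (b - meanAction p) (f - θ) := by
    rw [dotProduct_mulVec, vecMul_transpose, hproj, EuclideanSpace.inner_eq_star_dotProduct,
      star_trivial, dotProduct_comm]
  have hquad : (Bᵀ *ᵥ v) ⬝ᵥ N *ᵥ (Bᵀ *ᵥ v) = v ⬝ᵥ actionCov p *ᵥ v := by
    have h : ∀ N' : Matrix (Fin (affineDim A)) (Fin (affineDim A)) ℝ,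
        v ⬝ᵥ (B * N' * Bᵀ) *ᵥ v = (Bᵀ *ᵥ v) ⬝ᵥ N' *ᵥ (Bᵀ *ᵥ v) := fun N' => by
      rw [← Matrix.mulVec_mulVec, ← Matrix.mulVec_mulVec, dotProduct_mulVec v, ← mulVec_transpose]
    rw [← h N, hN, ← hB.actionCov_eq hA hp.1]
  have hvar : v ⬝ᵥ actionCov p *ᵥ v ≤ ∫ a : Vec d, (inner ℝ a (f - θ)) ^ 2 ∂p.toMeasure := by
    refine (actionCov_quadratic_le hA hp.1 v).trans_eq ?_
    simp only [EuclideanSpace.inner_eq_star_dotProduct, star_trivial, hv]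
    simp_rw [dotProduct_comm]
  have hkd : (affineDim A : ℝ) ≤ d := by exact_mod_cast hB.le
  have h1 : γ⁻¹ * (u ⬝ᵥ N⁻¹ *ᵥ u) ≤ d / γ + inner ℝ (b - meanAction p) θ := by
    rw [inv_mul_le_iff₀ hγ, mul_add, mul_div_cancel₀ _ hγ.ne']
    linarith
  have h2 : γ / 4 * ((Bᵀ *ᵥ v) ⬝ᵥ N *ᵥ (Bᵀ *ᵥ v))
      ≤ γ / 4 * ∫ a : Vec d, (inner ℝ a (f - θ)) ^ 2 ∂p.toMeasure := by
    rw [hquad]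
    exact mul_le_mul_of_nonneg_left hvar (by positivity)
  rw [huv, inner_sub_right] at hcs
  have h3 : inner ℝ (meanAction p - b) f = -inner ℝ (b - meanAction p) f := by
    rw [← inner_neg_left, neg_sub]
  linarith

/-! ### The oracle and the regret -/

/-- The regret bound is nonnegative, since every predictor is perfect when all actions and losses
are zero. -/
theorem RegressionOracle.HasRegretBound.nonneg {X : Type*} {d T : ℕ} {O : RegressionOracle X d}
    {F : Set (X → Vec d)} (hF : F.Nonempty) {R : ℝ} (hO : O.HasRegretBound F T R) (x : ℕ → X) :
    0 ≤ R := by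
  have : Nonempty F := hF.to_subtype
  simpa using hO x 0 0 (by simp) (by simp)

theorem RegressionOracle.HasRegretBound.sum_sub_le {X : Type*} {d T : ℕ} {O : RegressionOracle X d}
    {F : Set (X → Vec d)} {R : ℝ} (hO : O.HasRegretBound F T R) {f : X → Vec d} (hf : f ∈ F)
    {x : ℕ → X} {a : ℕ → Vec d} {l : ℕ → ℝ} (ha : ∀ t < T, ‖a t‖ ≤ 1)
    (hl : ∀ t < T, l t ∈ Set.Icc (-1 : ℝ) 1) :
    ∑ t ∈ Finset.range T, ((inner ℝ (a t) (O.prediction x a l t) - l t) ^ 2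
      - (inner ℝ (a t) (f (x t)) - l t) ^ 2) ≤ R := by
  rw [Finset.sum_sub_distrib]
  refine le_trans (sub_le_sub_left ?_ _) (hO x a l ha hl)
  refine ciInf_le (f := fun f : F => ∑ t ∈ Finset.range T, (inner ℝ (a t) (f.1 (x t)) - l t) ^ 2)
    ⟨0, ?_⟩ ⟨f, hf⟩
  rintro _ ⟨f, rfl⟩
  exact Finset.sum_nonneg fun t _ => sq_nonneg _

/-- The squared error of the linear model `⟨·, v⟩` for the mean losses in context `y`, in the
worst case over the action set `A`. -/
noncomputable def worstSqError {X : Type*} {d : ℕ} (mu : Vec d → X → ℝ) (A : Set (Vec d)) (y : X)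
    (v : Vec d) : ℝ :=
  ⨆ a : A, (inner ℝ a.1 v - mu a.1 y) ^ 2

section Model
variable {X : Type*} {d : ℕ} {mu : Vec d → X → ℝ} {A : Set (Vec d)} {y : X} {v : Vec d}

theorem worstSqError_nonneg : 0 ≤ worstSqError mu A y v := Real.iSup_nonneg fun _ => sq_nonneg _

theorem abs_inner_le_norm_of_norm_le_one {a : Vec d} (ha : ‖a‖ ≤ 1) (v : Vec d) :
    |inner ℝ a v| ≤ ‖v‖ :=
  (abs_real_inner_le_norm a v).trans (mul_le_of_le_one_left (norm_nonneg v) ha)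

theorem sq_le_worstSqError (hmu : ∀ b, ‖b‖ ≤ 1 → mu b y ∈ Set.Icc (-1 : ℝ) 1)
    (hA : ∀ b ∈ A, ‖b‖ ≤ 1) {a : Vec d} (ha : a ∈ A) :
    (inner ℝ a v - mu a y) ^ 2 ≤ worstSqError mu A y v := by
  refine le_ciSup (f := fun a : A => (inner ℝ a.1 v - mu a.1 y) ^ 2) ⟨(‖v‖ + 1) ^ 2, ?_⟩ ⟨a, ha⟩
  rintro _ ⟨⟨a, ha⟩, rfl⟩
  have h1 := abs_inner_le_norm_of_norm_le_one (hA a ha) v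
  have h2 : |mu a y| ≤ 1 := abs_le.2 (hmu a (hA a ha))
  refine sq_le_sq.2 ?_
  rw [abs_of_nonneg (by positivity : 0 ≤ ‖v‖ + 1)]
  exact (abs_sub _ _).trans (add_le_add h1 h2)

theorem abs_le_sqrt_worstSqError (hmu : ∀ b, ‖b‖ ≤ 1 → mu b y ∈ Set.Icc (-1 : ℝ) 1)
    (hA : ∀ b ∈ A, ‖b‖ ≤ 1) {a : Vec d} (ha : a ∈ A) :
    |inner ℝ a v - mu a y| ≤ √(worstSqError mu A y v) :=
  Real.abs_le_sqrt (sq_le_worstSqError hmu hA ha)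

end Model

namespace IsSquareCBLinRun

variable {X : Type*} {d : ℕ} {Ω : Type*} {mΩ : MeasurableSpace Ω} {P : Measure Ω}
  {ℱ : Filtration ℕ mΩ} {T : ℕ} {x : ℕ → X} {A : ℕ → Set (Vec d)}
  {mu : Vec d → X → ℝ} {O : RegressionOracle X d} {γ : ℝ}
  {p : ℕ → Ω → PMF (Vec d)} {a : ℕ → Ω → Vec d} {l : ℕ → Ω → ℝ} {t : ℕ}

theorem measurable_action (h : IsSquareCBLinRun P ℱ T x A mu O γ p a l) (ht : t < T) :
    Measurable (a t) :=
  (h.action_measurable t ht).mono (ℱ.le _) le_rfl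

theorem measurable_loss (h : IsSquareCBLinRun P ℱ T x A mu O γ p a l) (ht : t < T) :
    Measurable (l t) :=
  (h.loss_measurable t ht).mono (ℱ.le _) le_rfl

theorem measurable_prediction (h : IsSquareCBLinRun P ℱ T x A mu O γ p a l) (ht : t < T) :
    Measurable[ℱ t] fun ω => O.prediction x (fun s => a s ω) (fun s => l s ω) t := by
  refine (O.measurable_predict t _).comp ?_
  refine @measurable_pi_lambda _ _ _ (ℱ t) _ _ fun s => ?_
  exact ((h.action_measurable s (s.2.trans ht)).mono (ℱ.mono s.2) le_rfl).prodMk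
    ((h.loss_measurable s (s.2.trans ht)).mono (ℱ.mono s.2) le_rfl)

theorem norm_action_le (h : IsSquareCBLinRun P ℱ T x A mu O γ p a l)
    (hA : ∀ t < T, ∀ b ∈ A t, ‖b‖ ≤ 1) (ht : t < T) (ω : Ω) : ‖a t ω‖ ≤ 1 :=
  hA t ht _ (h.action_mem t ht ω)

theorem integrable_meanLoss (h : IsSquareCBLinRun P ℱ T x A mu O γ p a l) (ht : t < T) :
    Integrable (fun ω => mu (a t ω) (x t)) P :=
  integrable_condExp.congr (h.loss_mean t ht)

/-- The difference between the prediction of `f` and that of the oracle for the action played in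
round `t`. -/
noncomputable def predError (O : RegressionOracle X d) (x : ℕ → X) (a : ℕ → Ω → Vec d)
    (l : ℕ → Ω → ℝ) (f : X → Vec d) (t : ℕ) (ω : Ω) : ℝ :=
  inner ℝ (a t ω) (f (x t) - O.prediction x (fun s => a s ω) (fun s => l s ω) t)

theorem measurable_inner_const_sub {m : MeasurableSpace Ω} {u v : Ω → Vec d} (hu : Measurable u)
    (hv : Measurable v) (w : Vec d) : Measurable fun ω => (inner ℝ (u ω) (w - v ω) : ℝ) :=
  hu.inner (hv.const_sub w)

theorem measurable_predError (h : IsSquareCBLinRun P ℱ T x A mu O γ p a l) (f : X → Vec d)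
    (ht : t < T) :
    Measurable[ℱ t ⊔ MeasurableSpace.comap (a t) inferInstance] (predError O x a l f t) := by
  have h1 : Measurable[ℱ t ⊔ MeasurableSpace.comap (a t) inferInstance] (a t) :=
    (comap_measurable (a t)).mono le_sup_right le_rfl
  have h2 := (h.measurable_prediction ht).mono
    (le_sup_left (b := MeasurableSpace.comap (a t) inferInstance)) le_rfl
  exact measurable_inner_const_sub h1 h2 (f (x t))

theorem sup_comap_le (h : IsSquareCBLinRun P ℱ T x A mu O γ p a l) (ht : t < T) :
    ℱ t ⊔ MeasurableSpace.comap (a t) inferInstance ≤ mΩ :=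
  sup_le (ℱ.le t) (h.measurable_action ht).comap_le

variable {F : Set (X → Vec d)} {R : ℝ} {f : X → Vec d}

/-- The oracle's predictions are not assumed to be bounded, but its regret bound, applied to each
realization, bounds their values at the actions that are played. -/
theorem exists_predError_bound (h : IsSquareCBLinRun P ℱ T x A mu O γ p a l)
    (hA : ∀ t < T, ∀ b ∈ A t, ‖b‖ ≤ 1) (hO : O.HasRegretBound F T R) (hf : f ∈ F) (ht : t < T) :
    ∃ K, ∀ ω, |predError O x a l f t ω| ≤ K := by
  refine ⟨‖f (x t)‖ + (√(R + ∑ s ∈ Finset.range T, (‖f (x s)‖ + 1) ^ 2) + 1), fun ω => ?_⟩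
  have hb := hO.sum_sub_le hf (x := x) (fun s hs => h.norm_action_le hA hs ω)
    (fun s hs => h.loss_mem s hs ω)
  rw [Finset.sum_sub_distrib] at hb
  have h1 : ∑ s ∈ Finset.range T, (inner ℝ (a s ω) (f (x s)) - l s ω) ^ 2
      ≤ ∑ s ∈ Finset.range T, (‖f (x s)‖ + 1) ^ 2 := by
    refine Finset.sum_le_sum fun s hs => ?_
    rw [Finset.mem_range] at hs
    refine sq_le_sq.2 ?_
    rw [abs_of_nonneg (by positivity : 0 ≤ ‖f (x s)‖ + 1)]
    exact (abs_sub _ _).trans (add_le_add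
      (abs_inner_le_norm_of_norm_le_one (h.norm_action_le hA hs ω) _)
      (abs_le.2 (h.loss_mem s hs ω)))
  have h2 := Finset.single_le_sum (f := fun s => (inner ℝ (a s ω)
    (O.prediction x (fun s => a s ω) (fun s => l s ω) s) - l s ω) ^ 2)
    (fun s _ => sq_nonneg _) (Finset.mem_range.2 ht)
  have h3 := Real.abs_le_sqrt (h2.trans (show _ ≤ R + ∑ s ∈ Finset.range T, (‖f (x s)‖ + 1) ^ 2 by
    linarith))
  have h4 := abs_inner_le_norm_of_norm_le_one (h.norm_action_le hA ht ω) (f (x t))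
  have h5 := abs_le.2 (h.loss_mem t ht ω)
  rw [predError, inner_sub_right]
  rw [abs_le] at *
  constructor <;> linarith [h3.1, h3.2, h4.1, h4.2, h5.1, h5.2]

variable [IsProbabilityMeasure P]

theorem integrable_predError (h : IsSquareCBLinRun P ℱ T x A mu O γ p a l)
    (hA : ∀ t < T, ∀ b ∈ A t, ‖b‖ ≤ 1) (hO : O.HasRegretBound F T R) (hf : f ∈ F) (ht : t < T) :
    Integrable (predError O x a l f t) P := by
  obtain ⟨K, hK⟩ := h.exists_predError_bound hA hO hf ht
  exact Integrable.of_bound ((h.measurable_predError f ht).mono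
    (h.sup_comap_le ht) le_rfl).aestronglyMeasurable K (Filter.Eventually.of_forall hK)

theorem integrable_predError_mul (h : IsSquareCBLinRun P ℱ T x A mu O γ p a l)
    (hA : ∀ t < T, ∀ b ∈ A t, ‖b‖ ≤ 1) (hO : O.HasRegretBound F T R) (hf : f ∈ F) (ht : t < T)
    {g : Ω → ℝ} (hg : Integrable g P) :
    Integrable (fun ω => predError O x a l f t ω * g ω) P := by
  obtain ⟨K, hK⟩ := h.exists_predError_bound hA hO hf ht
  exact hg.bdd_mul (h.integrable_predError hA hO hf ht).aestronglyMeasurable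
    (Filter.Eventually.of_forall hK)

theorem integrable_loss (h : IsSquareCBLinRun P ℱ T x A mu O γ p a l) (ht : t < T) :
    Integrable (l t) P :=
  Integrable.of_bound (h.measurable_loss ht).aestronglyMeasurable 1
    (Filter.Eventually.of_forall fun ω => abs_le.2 (h.loss_mem t ht ω))

/-- Given the past and the action, the prediction error is known and the loss has mean `mu`. -/
theorem integral_predError_mul_loss (h : IsSquareCBLinRun P ℱ T x A mu O γ p a l)
    (hA : ∀ t < T, ∀ b ∈ A t, ‖b‖ ≤ 1) (hO : O.HasRegretBound F T R) (hf : f ∈ F) (ht : t < T) :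
    ∫ ω, predError O x a l f t ω * l t ω ∂P
      = ∫ ω, predError O x a l f t ω * mu (a t ω) (x t) ∂P := by
  rw [← integral_condExp (h.sup_comap_le ht)]
  refine integral_congr_ae ?_
  have h1 := condExp_mul_of_stronglyMeasurable_left (μ := P)
    (h.measurable_predError f ht).stronglyMeasurable
    (h.integrable_predError_mul hA hO hf ht (h.integrable_loss ht)) (h.integrable_loss ht)
  filter_upwards [h1, h.loss_mean t ht] with ω h1 h2
  refine h1.trans ?_
  rw [Pi.mul_apply, h2]

/-- The expected squared distance between the predictions of the oracle and those of `f`. -/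
theorem integral_sum_sq_predError_le (h : IsSquareCBLinRun P ℱ T x A mu O γ p a l)
    (hmu : ∀ (b : Vec d) (y : X), ‖b‖ ≤ 1 → mu b y ∈ Set.Icc (-1 : ℝ) 1)
    (hA : ∀ t < T, ∀ b ∈ A t, ‖b‖ ≤ 1) (hO : O.HasRegretBound F T R) (hf : f ∈ F) :
    ∑ t ∈ Finset.range T, ∫ ω, predError O x a l f t ω ^ 2 ∂P
      ≤ 2 * R + 4 * ∑ t ∈ Finset.range T, worstSqError mu (A t) (x t) (f (x t)) := by
  have hi2 : ∀ t ∈ Finset.range T, Integrable (fun ω => predError O x a l f t ω ^ 2) P := by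
    intro t ht
    simp_rw [sq]
    exact h.integrable_predError_mul hA hO hf (Finset.mem_range.1 ht)
      (h.integrable_predError hA hO hf (Finset.mem_range.1 ht))
  have hiz : ∀ t ∈ Finset.range T, Integrable (fun ω =>
      predError O x a l f t ω * mu (a t ω) (x t) - predError O x a l f t ω * l t ω) P := by
    intro t ht
    rw [Finset.mem_range] at ht
    exact (h.integrable_predError_mul hA hO hf ht (h.integrable_meanLoss ht)).sub
      (h.integrable_predError_mul hA hO hf ht (h.integrable_loss ht))
  have hz : ∫ ω, ∑ t ∈ Finset.range T, (predError O x a l f t ω * mu (a t ω) (x t)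
      - predError O x a l f t ω * l t ω) ∂P = 0 := by
    rw [integral_finsetSum _ hiz]
    refine Finset.sum_eq_zero fun t ht => ?_
    rw [Finset.mem_range] at ht
    rw [integral_sub (h.integrable_predError_mul hA hO hf ht (h.integrable_meanLoss ht))
      (h.integrable_predError_mul hA hO hf ht (h.integrable_loss ht)),
      h.integral_predError_mul_loss hA hO hf ht, sub_self]
  have hpt : ∀ ω, ∑ t ∈ Finset.range T, predError O x a l f t ω ^ 2
      ≤ 2 * R + 4 * ∑ t ∈ Finset.range T, worstSqError mu (A t) (x t) (f (x t))
        + 4 * ∑ t ∈ Finset.range T, (predError O x a l f t ω * mu (a t ω) (x t)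
          - predError O x a l f t ω * l t ω) := by
    intro ω
    have hb := hO.sum_sub_le hf (x := x) (fun s hs => h.norm_action_le hA hs ω)
      (fun s hs => h.loss_mem s hs ω)
    refine le_trans ?_ (add_le_add_left (add_le_add_left
      (mul_le_mul_of_nonneg_left hb zero_le_two) _) _)
    rw [Finset.mul_sum, Finset.mul_sum, Finset.mul_sum, ← Finset.sum_add_distrib,
      ← Finset.sum_add_distrib]
    refine Finset.sum_le_sum fun t ht => ?_
    rw [Finset.mem_range] at ht
    have hs := sq_le_worstSqError (v := f (x t)) (fun b => hmu b (x t)) (hA t ht)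
      (h.action_mem t ht ω)
    rw [predError, inner_sub_right]
    set g : ℝ := inner ℝ (a t ω) (f (x t))
    set q : ℝ := inner ℝ (a t ω) (O.prediction x (fun s => a s ω) (fun s => l s ω) t)
    set m := mu (a t ω) (x t)
    -- `(q - l)² - (g - l)² = (q - g)² + 2 (q - g) (g - m) + 2 (q - g) (m - l)`, where the middle
    -- term is at least `-(q - g)² / 2 - 2 (g - m)²`.
    nlinarith [sq_nonneg ((q - g) + 2 * (g - m))]
  rw [← integral_finsetSum _ hi2]
  calc _ ≤ _ := integral_mono (integrable_finsetSum _ hi2)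
        ((integrable_const _).add ((integrable_finsetSum _ hiz).const_mul 4)) hpt
    _ = _ := by
      rw [integral_add' (integrable_const _) ((integrable_finsetSum _ hiz).const_mul 4),
        integral_const_mul, hz]
      simp

/-- The expected regret of round `t`. -/
theorem integral_meanLoss_sub_le (h : IsSquareCBLinRun P ℱ T x A mu O γ p a l) (hγ : 0 < γ)
    (hmu : ∀ (b : Vec d) (y : X), ‖b‖ ≤ 1 → mu b y ∈ Set.Icc (-1 : ℝ) 1)
    (hA : ∀ t < T, ∀ b ∈ A t, ‖b‖ ≤ 1) (hO : O.HasRegretBound F T R) (hf : f ∈ F) (ht : t < T) :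
    ∫ ω, mu (a t ω) (x t) ∂P - ⨅ b : A t, mu b.1 (x t)
      ≤ 2 * √(worstSqError mu (A t) (x t) (f (x t))) + d / γ
        + γ / 4 * ∫ ω, predError O x a l f t ω ^ 2 ∂P := by
  set s := √(worstSqError mu (A t) (x t) (f (x t)))
  obtain ⟨ω₀⟩ := nonempty_of_isProbabilityMeasure P
  have : Nonempty (A t) := ⟨⟨_, h.action_mem t ht ω₀⟩⟩
  have hg : Integrable (fun ω => inner ℝ (a t ω) (f (x t))) P :=
    Integrable.of_bound ((h.measurable_action ht).inner_const).aestronglyMeasurable ‖f (x t)‖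
      (Filter.Eventually.of_forall fun ω =>
        abs_inner_le_norm_of_norm_le_one (h.norm_action_le hA ht ω) _)
  have he2 : Integrable (fun ω => predError O x a l f t ω ^ 2) P := by
    simp_rw [sq]
    exact h.integrable_predError_mul hA hO hf ht (h.integrable_predError hA hO hf ht)
  have hcond1 := condExp_prod_ae_eq_integral_pmf (ℱ.le t) (h.measurable_action ht)
    (h.action_law t ht) (V := fun _ => ()) measurable_const
    (f := fun z : Unit × Vec d => inner ℝ z.2 (f (x t))) (by fun_prop) hg
  have hcond2 := condExp_prod_ae_eq_integral_pmf (ℱ.le t) (h.measurable_action ht)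
    (h.action_law t ht) (h.measurable_prediction ht)
    (f := fun z : Vec d × Vec d => inner ℝ z.2 (f (x t) - z.1) ^ 2) (by fun_prop) he2
  have hmean : ∀ ω, ∫ b, inner ℝ b (f (x t)) ∂(p t ω).toMeasure
      = inner ℝ (meanAction (p t ω)) (f (x t)) := fun ω => by
    have := integral_dotProduct (hA t ht) (h.barrier t ht ω).1 (f (x t)).ofLp
    simpa only [EuclideanSpace.inner_eq_star_dotProduct, star_trivial, dotProduct_comm] using this
  have hstep : ∀ b ∈ A t, ∫ ω, inner ℝ (a t ω) (f (x t)) ∂P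
      ≤ inner ℝ b (f (x t)) + d / γ + γ / 4 * ∫ ω, predError O x a l f t ω ^ 2 ∂P := by
    intro b hb
    have hae : ∀ᵐ ω ∂P, (P[fun ω => inner ℝ (a t ω) (f (x t)) | ℱ t]) ω
        ≤ inner ℝ b (f (x t)) + d / γ
          + γ / 4 * (P[fun ω => predError O x a l f t ω ^ 2 | ℱ t]) ω := by
      filter_upwards [hcond1, hcond2] with ω h1 h2
      have h3 := inner_meanAction_sub_le (hA t ht) hγ (h.barrier t ht ω) hb (f (x t))
      rw [h1, hmean]
      refine le_trans ?_ (add_le_add_right (mul_le_mul_of_nonneg_left h2.ge (by positivity)) _)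
      rw [inner_sub_left] at h3
      linarith
    have hint := integral_mono_ae integrable_condExp
      ((integrable_const _).add (integrable_condExp.const_mul _)) hae
    rw [integral_condExp (ℱ.le t)] at hint
    refine hint.trans_eq ?_
    rw [integral_add (integrable_const _) (integrable_condExp.const_mul _), integral_const_mul,
      integral_condExp (ℱ.le t)]
    simp
  have hup : ∫ ω, mu (a t ω) (x t) ∂P ≤ ∫ ω, inner ℝ (a t ω) (f (x t)) ∂P + s := by
    have := integral_mono (h.integrable_meanLoss ht) (hg.add (integrable_const s)) fun ω => by
      have := (abs_le.1 (abs_le_sqrt_worstSqError (v := f (x t)) (fun b => hmu b (x t)) (hA t ht)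
        (h.action_mem t ht ω))).1
      simp only [Pi.add_apply]
      linarith
    refine this.trans_eq ?_
    rw [integral_add' hg (integrable_const s)]
    simp
  suffices hs : ∫ ω, mu (a t ω) (x t) ∂P - (2 * s + d / γ
      + γ / 4 * ∫ ω, predError O x a l f t ω ^ 2 ∂P) ≤ ⨅ b : A t, mu b.1 (x t) by linarith
  refine le_ciInf fun b => ?_
  have h1 := hstep b.1 b.2
  have h2 := (abs_le.1 (abs_le_sqrt_worstSqError (v := f (x t)) (fun b => hmu b (x t)) (hA t ht)
    b.2)).2
  linarith

theorem integrable_excessLoss (h : IsSquareCBLinRun P ℱ T x A mu O γ p a l) :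
    Integrable (fun ω => excessLoss mu T x A (fun t => a t ω)) P :=
  integrable_finsetSum _ fun _ ht =>
    (h.integrable_meanLoss (Finset.mem_range.1 ht)).sub (integrable_const _)

/-- The regret bound before tuning, where `m` bounds the misspecification level of one `f` in the
class. -/
theorem integral_excessLoss_le (h : IsSquareCBLinRun P ℱ T x A mu O γ p a l) (hT : 0 < T)
    (hγ : 0 < γ)
    (hmu : ∀ (b : Vec d) (y : X), ‖b‖ ≤ 1 → mu b y ∈ Set.Icc (-1 : ℝ) 1)
    (hA : ∀ t < T, ∀ b ∈ A t, ‖b‖ ≤ 1) (hO : O.HasRegretBound F T R) (hf : f ∈ F) {m : ℝ}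
    (hm : √((1 / (T : ℝ)) * ∑ t ∈ Finset.range T, worstSqError mu (A t) (x t) (f (x t))) ≤ m) :
    ∫ ω, excessLoss mu T x A (fun t => a t ω) ∂P
      ≤ 2 * m * T + d * T / γ + γ / 2 * (R + 2 * (m ^ 2 * T)) := by
  have hT' : (0 : ℝ) < T := by exact_mod_cast hT
  have hm0 : 0 ≤ m := (Real.sqrt_nonneg _).trans hm
  set w := fun t => worstSqError mu (A t) (x t) (f (x t)) with hw
  have hsum : ∑ t ∈ Finset.range T, w t ≤ m ^ 2 * T := by
    have := (Real.sqrt_le_left hm0).1 hm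
    rwa [one_div, inv_mul_le_iff₀ hT', mul_comm] at this
  have hsqrt : ∑ t ∈ Finset.range T, √(w t) ≤ m * T := by
    refine abs_le_of_sq_le_sq' ?_ (by positivity) |>.2
    calc (∑ t ∈ Finset.range T, √(w t)) ^ 2
        ≤ (Finset.range T).card * ∑ t ∈ Finset.range T, √(w t) ^ 2 := sq_sum_le_card_mul_sum_sq
      _ = T * ∑ t ∈ Finset.range T, w t := by
        rw [Finset.card_range]
        congr 1
        exact Finset.sum_congr rfl fun t _ => Real.sq_sqrt worstSqError_nonneg
      _ ≤ T * (m ^ 2 * T) := mul_le_mul_of_nonneg_left hsum hT'.le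
      _ = (m * T) ^ 2 := by ring
  have hsq := h.integral_sum_sq_predError_le hmu hA hO hf
  have hround : ∫ ω, excessLoss mu T x A (fun t => a t ω) ∂P
      ≤ ∑ t ∈ Finset.range T, (2 * √(w t) + d / γ
        + γ / 4 * ∫ ω, predError O x a l f t ω ^ 2 ∂P) := by
    have hi : ∀ t ∈ Finset.range T,
        Integrable (fun ω => mu (a t ω) (x t) - ⨅ b : A t, mu b.1 (x t)) P := fun t ht =>
      (h.integrable_meanLoss (Finset.mem_range.1 ht)).sub (integrable_const _)
    simp only [excessLoss]
    rw [integral_finsetSum _ hi]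
    refine Finset.sum_le_sum fun t ht => ?_
    rw [integral_sub (h.integrable_meanLoss (Finset.mem_range.1 ht)) (integrable_const _)]
    simpa using h.integral_meanLoss_sub_le hγ hmu hA hO hf (Finset.mem_range.1 ht)
  rw [Finset.sum_add_distrib, Finset.sum_add_distrib, ← Finset.mul_sum, ← Finset.mul_sum,
    Finset.sum_const, Finset.card_range, nsmul_eq_mul] at hround
  have h1 : γ / 4 * ∑ t ∈ Finset.range T, ∫ ω, predError O x a l f t ω ^ 2 ∂P
      ≤ γ / 4 * (2 * R + 4 * (m ^ 2 * T)) :=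
    mul_le_mul_of_nonneg_left (by linarith) (by positivity)
  have h2 : (T : ℝ) * (d / γ) = d * T / γ := by ring
  linarith

end IsSquareCBLinRun

/-- The choice of the learning rate balances the terms of the regret bound. -/
theorem regret_tuning {c d T R ε γ : ℝ} (hc : 0 < c) (hd : 1 ≤ d) (hT : 0 < T) (hR : 0 ≤ R)
    (hε : 0 ≤ ε) (hpos : 0 < R + ε ^ 2 * T) (hγ : γ = c * √(d * T / (R + ε ^ 2 * T))) :
    2 * ε * T + d * T / γ + γ / 2 * (R + 2 * (ε ^ 2 * T))
      ≤ (2 + 1 / c + c) * (√(d * T * R) + ε * √d * T) := by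
  set G := R + ε ^ 2 * T with hG
  have hdT : 0 < d * T := by positivity
  set r := √(d * T / G) with hr
  have hr0 : 0 < r := Real.sqrt_pos.2 (by positivity)
  have hrsq : r ^ 2 * G = d * T := by
    rw [hr, Real.sq_sqrt (by positivity), div_mul_cancel₀ _ hpos.ne']
  have hrG : r * G ≤ √(d * T * R) + ε * √d * T := by
    have h1 : r * G = √(d * T * G) := by
      symm
      rw [Real.sqrt_eq_iff_mul_self_eq (by positivity) (by positivity)]
      linear_combination -G * hrsq
    rw [h1, hG, mul_add]
    refine Real.sqrt_le_iff.2 ⟨by positivity, ?_⟩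
    have e1 := Real.sq_sqrt (by positivity : 0 ≤ d * T * R)
    have e2 := Real.sq_sqrt (by linarith : 0 ≤ d)
    have e3 : 0 ≤ √(d * T * R) * (ε * √d * T) := by positivity
    calc d * T * R + d * T * (ε ^ 2 * T)
        = √(d * T * R) ^ 2 + (ε * √d * T) ^ 2 := by
          rw [e1]
          linear_combination -(ε ^ 2 * T ^ 2) * e2
      _ ≤ _ := by linarith [add_sq (√(d * T * R)) (ε * √d * T)]
  have h1 : d * T / γ = 1 / c * (r * G) := by
    rw [hγ, ← hrsq]
    field_simp
  have h2 : γ / 2 * (R + 2 * (ε ^ 2 * T)) ≤ c * (r * G) := by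
    have : γ / 2 * (R + 2 * (ε ^ 2 * T)) ≤ γ / 2 * (2 * G) :=
      mul_le_mul_of_nonneg_left (by linarith) (by rw [hγ]; positivity)
    refine this.trans_eq ?_
    rw [hγ]
    ring
  have h3 : 2 * ε * T ≤ 2 * (√(d * T * R) + ε * √d * T) := by
    have : ε * T * 1 ≤ ε * T * √d :=
      mul_le_mul_of_nonneg_left (Real.one_le_sqrt.2 hd) (by positivity)
    have := Real.sqrt_nonneg (d * T * R)
    linarith
  have h4 := mul_le_mul_of_nonneg_left hrG (by positivity : 0 ≤ 1 / c + c)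
  rw [h1]
  linarith

end LinearCB

theorem theorem5 (c : ℝ) (hc : 0 < c) :
    ∃ C : ℝ, 0 < C ∧
      ∀ (d : ℕ) (_ : 0 < d) (T : ℕ) (_ : 0 < T)
        (X : Type*) (F : Set (X → LinearCB.Vec d)) (_ : F.Nonempty)
        -- the regression oracle and its square loss regret guarantee
        (O : LinearCB.RegressionOracle X d) (RegSq : ℕ → ℝ)
        (_ : O.HasRegretBound F T (RegSq T))
        -- the mean loss function (losses take values in [-1, 1])
        (mu : LinearCB.Vec d → X → ℝ)
        (_ : ∀ (b : LinearCB.Vec d) (y : X), ‖b‖ ≤ 1 → mu b y ∈ Set.Icc (-1 : ℝ) 1)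
        -- the learning rate
        (ε : ℝ) (_ : 0 < RegSq T + ε ^ 2 * T)
        (γ : ℝ) (_ : γ = c * Real.sqrt (d * T / (RegSq T + ε ^ 2 * T)))
        -- the sequence of contexts and action sets
        (x : ℕ → X) (A : ℕ → Set (LinearCB.Vec d))
        (_ : ∀ t < T, ∀ b ∈ A t, ‖b‖ ≤ 1)
        (_ : LinearCB.misspecification F mu T x A ≤ ε)
        -- the interaction of the algorithm with the environment
        (Ω : Type*) (mΩ : MeasurableSpace Ω) (P : MeasureTheory.Measure Ω)
        (_ : MeasureTheory.IsProbabilityMeasure P) (ℱ : MeasureTheory.Filtration ℕ mΩ)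
        (p : ℕ → Ω → PMF (LinearCB.Vec d)) (a : ℕ → Ω → LinearCB.Vec d) (l : ℕ → Ω → ℝ)
        (_ : LinearCB.IsSquareCBLinRun P ℱ T x A mu O γ p a l),
        MeasureTheory.Integrable
            (fun ω => LinearCB.excessLoss mu T x A (fun t => a t ω)) P ∧
          ∫ ω, LinearCB.excessLoss mu T x A (fun t => a t ω) ∂P
            ≤ C * (Real.sqrt (d * T * RegSq T) + ε * Real.sqrt d * T) := by
  refine ⟨2 + 1 / c + c, by positivity, ?_⟩
  intro d hd T hT X F hF O RegSq hO mu hmu ε hpos γ hγ x A hA hmis Ω mΩ P hP ℱ p a l h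
  refine ⟨h.integrable_excessLoss, ?_⟩
  have hFne : Nonempty F := hF.to_subtype
  have hR : 0 ≤ RegSq T := hO.nonneg hF x
  have hε : 0 ≤ ε := (Real.iInf_nonneg fun _ => Real.sqrt_nonneg _).trans hmis
  have hd1 : (1 : ℝ) ≤ d := by exact_mod_cast hd
  have hT0 : (0 : ℝ) < T := by exact_mod_cast hT
  have hγ0 : 0 < γ := by
    rw [hγ]
    have : (0 : ℝ) < d * T / (RegSq T + ε ^ 2 * T) := by positivity
    positivity
  refine le_trans ?_ (LinearCB.regret_tuning hc hd1 hT0 hR hε hpos hγ)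
  -- The infimum that defines the misspecification level need not be attained.
  have hbound : ∀ m, ε < m → ∫ ω, LinearCB.excessLoss mu T x A (fun t => a t ω) ∂P
      ≤ 2 * m * T + d * T / γ + γ / 2 * (RegSq T + 2 * (m ^ 2 * T)) := by
    intro m hm
    obtain ⟨f, hf⟩ := exists_lt_of_ciInf_lt (lt_of_le_of_lt hmis hm)
    exact h.integral_excessLoss_le hT hγ0 hmu hA hO f.2 hf.le
  have hcont : Continuous fun m : ℝ =>
      2 * m * T + d * T / γ + γ / 2 * (RegSq T + 2 * (m ^ 2 * T)) := by fun_prop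
  exact ge_of_tendsto (hcont.continuousWithinAt (s := Set.Ioi ε)).tendsto
    (Filter.eventually_of_mem self_mem_nhdsWithin hbound)
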